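/- Let $P$ be a Markov kernel on a measurable space $(\mathcal X,\mathcal F)$ with stationary probability measure $\pi$. Assume that $P(x,\cdot)$, for every $x$, and $\pi$ have densities $p(x,\cdot)$ and $\pi(\cdot)$ with respect to a common reference measure $\mu$, where $p$ is jointly measurable and $\mu(\{x:\pi(x)=0\})=0$. Let $p^*(x,y)=\pi(y)p(y,x)/\pi(x)$ be the density of the time reversal $P^*$ of $P$, and put $$\alpha_1(x,y)=\begin{cases}\min\Big(\dfrac{\pi(y)p(y,x)}{\pi(x)p(x,y)},1\Big)&\text{if }\pi(x)p(x,y)>0,\\ 0&\text{otherwise,}\end{cases}\qquad r_1(x)=\int_{y\neq x}(1-\alpha_1(x,y))\,p(x,y)\,\mu(dy).$$ The first and second Metropolis--Hastings kernels of $P$ are $$M_1(x,dy)=\alpha_1(x,y)p(x,y)\,\mu(dy)+r_1(x)\,\delta_x(dy),\qquad M_2(x,dy)=\max\{p^*(x,y),p(x,y)\}\,\mu(dy)-r_1(x)\,\delta_x(dy),$$ where $\alpha_1(x,y)p(x,y)=\min\{p^*(x,y),p(x,y)\}$. Both act as bounded operators on the complex Hilbert space $L^2(\pi)$; $M_2$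 need not be a Markov kernel, and $P$ may or may not be reversible. Let $n\ge 1$. For $i=1,2$ suppose that $M_i$ satisfies the dominant-spectrum assumption: there are real numbers $1=\lambda_1^{(i)}>\lambda_2^{(i)}\ge\dots\ge\lambda_n^{(i)}$ and $-1<a_i\le b_i<\lambda_n^{(i)}$ such that $\lambda_1^{(i)},\dots,\lambda_n^{(i)}$ are eigenvalues of $M_i$ on $L^2(\pi)$, each listed as often as its (finite) multiplicity, and the spectrum of $M_i$ on $L^2(\pi)$ (the point $0$ included, if it belongs to it) is contained in $[a_i,b_i]\cup\{\lambda_n^{(i)},\dots,\lambda_1^{(i)}\}$. Let $\phi_1^{(2)},\dots,\phi_n^{(2)}$ be orthonormal in $L^2(\pi)$ with $M_2\phi_j^{(2)}=\lambda_j^{(2)}\phi_j^{(2)}$. Let $\mathcal D=\{A_1,\dots,A_n\}$ be a partition of $\mathcal X$ into $n$ measurable sets with $\pi(A_i)>0$ for all $i$, and let $$m(\mathcal D)=\sum_{i=1}^n \frac1{\pi(A_i)}\int_{A_i}P(x,A_i)\,\pi(dx)$$ be its metastability. Let $\Gamma$ be the orthogonal projection of $L^2(\pi)$ onto $\mathrm{Span}\{\mathbf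 1_{A_1},\dots,\mathbf 1_{A_n}\}$, let $\rho_j=\|\Gamma\phi_j^{(2)}\|_\pi^2$ for $1\le j\le n$, and let $c=a_2\sum_{j=2}^n(1-\rho_j)$. Then $\rho_j\in[0,1]$ for all $j$, and $$1+\sum_{j=2}^n\rho_j\lambda_j^{(2)}+c\;\le\; m(\mathcal D)\;\le\;1+\sum_{j=2}^n\lambda_j^{(1)}.$$ -/

import Mathlib

open MeasureTheory ProbabilityTheory
open scoped ENNReal NNReal

noncomputable section

namespace MHChain

/-! ### The Markov chain, its stationary law and the densities -/

/-- A Markov kernel `P` on a measurable space with a stationary probability measure `π`, such that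
`P(x, ·)` and `π` have densities `p(x, ·)` and `w` with respect to a reference measure `μ`, and
the set where `w` vanishes is `μ`-null. -/
structure StationaryChain (X : Type*) [MeasurableSpace X] where
  /-- the reference measure -/
  μ : Measure X
  /-- the stationary distribution -/
  π : Measure X
  /-- the Markov kernel -/
  P : Kernel X X
  /-- the density of `π` -/
  w : X → ℝ≥0
  /-- the transition density -/
  p : X → X → ℝ≥0
  isProbabilityMeasure : IsProbabilityMeasure π
  isMarkovKernel : IsMarkovKernel P
  measurable_w : Measurable w
  measurable_p : Measurable (Function.uncurry p)
  π_eq : π = μ.withDensity (fun x => (w x : ℝ≥0∞))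
  P_eq : ∀ x, P x = μ.withDensity (fun y => (p x y : ℝ≥0∞))
  w_ne_zero : ∀ᵐ x ∂μ, w x ≠ 0
  stationary : Kernel.Invariant P π

variable {X : Type*} [MeasurableSpace X] (C : StationaryChain X)

instance : IsProbabilityMeasure C.π := C.isProbabilityMeasure

instance : IsMarkovKernel C.P := C.isMarkovKernel

namespace StationaryChain

/-- The complex Hilbert space `L²(π)`. -/
abbrev L2 : Type _ := Lp ℂ 2 C.π

/-! ### The densities of the two Metropolis–Hastings kernels -/

/-- The density `p*(x, y) = w(y) p(y, x) / w(x)` of the time reversal `P*`, determined by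
`π(dx) P*(x, dy) = π(dy) P(y, dx)`. -/
def pStar (x y : X) : ℝ≥0 := C.w y * C.p y x / C.w x

/-- The acceptance probability of the first Metropolis–Hastings chain. -/
def α₁ (x y : X) : ℝ≥0 :=
  if 0 < C.w x * C.p x y then min ((C.w y * C.p y x) / (C.w x * C.p x y)) 1 else 0

/-- The density of the first Metropolis–Hastings kernel off the diagonal. -/
def m₁ (x y : X) : ℝ≥0 := C.α₁ x y * C.p x y

/-- The density of the second Metropolis–Hastings kernel off the diagonal. -/
def m₂ (x y : X) : ℝ≥0 := max (C.pStar x y) (C.p x y)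

/-- The rejection probability of the first Metropolis–Hastings chain. -/
def r₁ (x : X) : ℝ := ∫ y in ({x}ᶜ : Set X), (1 - (C.α₁ x y : ℝ)) * (C.p x y : ℝ) ∂C.μ

/-- Action on functions of `M₁(x, dy) = m₁(x, y) μ(dy) + r₁(x) δ_x(dy)`. -/
def M₁act (f : X → ℂ) (x : X) : ℂ := (∫ y, (C.m₁ x y : ℂ) * f y ∂C.μ) + (C.r₁ x : ℂ) * f x

/-- Action on functions of `M₂(x, dy) = m₂(x, y) μ(dy) - r₁(x) δ_x(dy)`. -/
def M₂act (f : X → ℂ) (x : X) : ℂ := (∫ y, (C.m₂ x y : ℂ) * f y ∂C.μ) - (C.r₁ x : ℂ) * f x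

/-! ### Elementary facts needed to see that the kernels act on `L²(π)` -/

theorem m₁_eq_min (x y : X) : C.m₁ x y = min (C.pStar x y) (C.p x y) := by
  unfold m₁ α₁ pStar
  by_cases hw : C.w x = 0
  · simp [hw]
  by_cases hp : C.p x y = 0
  · simp [hp]
  have h : 0 < C.w x * C.p x y := pos_iff_ne_zero.2 (mul_ne_zero hw hp)
  rw [if_pos h, min_mul_of_nonneg _ _ (show (0 : ℝ≥0) ≤ C.p x y from bot_le), one_mul]
  congr 1
  field_simp

theorem α₁_le_one (x y : X) : C.α₁ x y ≤ 1 := by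
  unfold α₁
  split_ifs <;> simp

theorem measurable_p_swap : Measurable (fun z : X × X => C.p z.2 z.1) :=
  C.measurable_p.comp measurable_swap

theorem measurable_pStar : Measurable (Function.uncurry C.pStar) := by
  have h1 : Measurable (fun z : X × X => C.w z.2 * C.p z.2 z.1 / C.w z.1) :=
    ((C.measurable_w.comp measurable_snd).mul C.measurable_p_swap).div
      (C.measurable_w.comp measurable_fst)
  exact h1

theorem measurable_m₁ : Measurable (Function.uncurry C.m₁) := by
  have h : Function.uncurry C.m₁
      = fun z => min (Function.uncurry C.pStar z) (Function.uncurry C.p z) := by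
    funext z
    exact C.m₁_eq_min z.1 z.2
  rw [h]
  exact C.measurable_pStar.min C.measurable_p

theorem measurable_m₂ : Measurable (Function.uncurry C.m₂) :=
  C.measurable_pStar.max C.measurable_p

theorem m₁_le (x y : X) : C.m₁ x y ≤ C.pStar x y + C.p x y := by
  rw [m₁_eq_min]
  exact (min_le_right _ _).trans le_add_self

theorem m₂_le (x y : X) : C.m₂ x y ≤ C.pStar x y + C.p x y :=
  max_le le_self_add le_add_self

theorem ae_iff {q : X → Prop} : (∀ᵐ x ∂C.π, q x) ↔ ∀ᵐ x ∂C.μ, q x := by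
  have hm : Measurable (fun x => (C.w x : ℝ≥0∞)) := C.measurable_w.coe_nnreal_ennreal
  rw [C.π_eq, ae_withDensity_iff hm]
  constructor
  · intro h
    filter_upwards [h, C.w_ne_zero] with x h1 h2
    exact h1 (by simpa using h2)
  · intro h
    filter_upwards [h] with x h1 _
    exact h1

instance : SFinite C.μ := by
  have hm : Measurable (fun x => (C.w x : ℝ≥0∞)) := C.measurable_w.coe_nnreal_ennreal
  have h := withDensity_inv_same (μ := C.μ) hm
    (by filter_upwards [C.w_ne_zero] with x hx; simpa using hx)
    (by simp)
  rw [← h, ← C.π_eq]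
  infer_instance

theorem lintegral_π {f : X → ℝ≥0∞} (hf : Measurable f) :
    ∫⁻ x, f x ∂C.π = ∫⁻ x, C.w x * f x ∂C.μ := by
  rw [C.π_eq, lintegral_withDensity_eq_lintegral_mul _ C.measurable_w.coe_nnreal_ennreal hf]
  rfl

theorem lintegral_w_mul_p :
    ∀ᵐ y ∂C.μ, ∫⁻ x, C.w x * C.p x y ∂C.μ = C.w y := by
  have hw : Measurable (fun x => (C.w x : ℝ≥0∞)) := C.measurable_w.coe_nnreal_ennreal
  have hp : Measurable (fun z : X × X => (C.p z.1 z.2 : ℝ≥0∞)) :=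
    C.measurable_p.coe_nnreal_ennreal
  have hj : Measurable (fun z : X × X => (C.w z.1 * C.p z.1 z.2 : ℝ≥0∞)) :=
    (hw.comp measurable_fst).mul hp
  have hm : Measurable (fun y => ∫⁻ x, C.w x * C.p x y ∂C.μ) := hj.lintegral_prod_left'
  have key : C.μ.withDensity (fun y => (C.w y : ℝ≥0∞))
      = C.μ.withDensity (fun y => ∫⁻ x, C.w x * C.p x y ∂C.μ) := by
    rw [← C.π_eq]
    ext s hs
    have h1 : C.π s = ∫⁻ x, C.P x s ∂C.π := by
      conv_lhs => rw [← C.stationary.def]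
      exact Measure.bind_apply hs C.P.measurable.aemeasurable
    rw [h1, withDensity_apply _ hs, C.lintegral_π (C.P.measurable_coe hs),
      lintegral_lintegral_swap (by exact (hj.comp measurable_swap).aemeasurable)]
    refine lintegral_congr fun x => ?_
    rw [lintegral_const_mul _ (show Measurable fun y => (C.p x y : ℝ≥0∞) from
      hp.comp measurable_prodMk_left), C.P_eq x, withDensity_apply _ hs]
  have := (withDensity_eq_iff hw.aemeasurable hm.aemeasurable ?_).1 key
  · filter_upwards [this] with y hy
    exact hy.symm
  · have h2 : ∫⁻ x, (C.w x : ℝ≥0∞) ∂C.μ = C.π Set.univ := by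
      rw [C.π_eq, withDensity_apply _ MeasurableSet.univ, setLIntegral_univ]
    rw [h2]
    simp

theorem lintegral_p (x : X) : ∫⁻ y, (C.p x y : ℝ≥0∞) ∂C.μ = 1 := by
  have h : C.P x Set.univ = 1 := measure_univ
  rwa [C.P_eq x, withDensity_apply _ MeasurableSet.univ, setLIntegral_univ] at h

theorem lintegral_pStar_le : ∀ᵐ x ∂C.μ, ∫⁻ y, (C.pStar x y : ℝ≥0∞) ∂C.μ ≤ 1 := by
  have hw : Measurable (fun x => (C.w x : ℝ≥0∞)) := C.measurable_w.coe_nnreal_ennreal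
  have hp : Measurable (fun z : X × X => (C.p z.1 z.2 : ℝ≥0∞)) :=
    C.measurable_p.coe_nnreal_ennreal
  filter_upwards [C.lintegral_w_mul_p, C.w_ne_zero] with x hx hx0
  have h : ∀ y, (C.pStar x y : ℝ≥0∞) = (C.w x : ℝ≥0∞)⁻¹ * (C.w y * C.p y x) := by
    intro y
    unfold pStar
    rw [ENNReal.coe_div hx0, ENNReal.div_eq_inv_mul, ENNReal.coe_mul]
  simp_rw [h]
  rw [lintegral_const_mul _ (show Measurable fun y => (C.w y * C.p y x : ℝ≥0∞) from
    hw.mul (hp.comp measurable_prodMk_right)), hx]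
  exact ENNReal.inv_mul_le_one _

theorem lintegral_w_mul_pStar_le (y : X) :
    ∫⁻ x, C.w x * C.pStar x y ∂C.μ ≤ C.w y := by
  have hp : Measurable (fun x => (C.p y x : ℝ≥0∞)) :=
    C.measurable_p.coe_nnreal_ennreal.comp measurable_prodMk_left
  calc ∫⁻ x, C.w x * C.pStar x y ∂C.μ ≤ ∫⁻ x, C.w y * C.p y x ∂C.μ := by
        refine lintegral_mono fun x => ?_
        rw [← ENNReal.coe_mul, ← ENNReal.coe_mul, ENNReal.coe_le_coe]
        unfold pStar
        by_cases h : C.w x = 0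
        · simp [h]
        · rw [mul_div_cancel₀ _ h]
    _ = C.w y := by rw [lintegral_const_mul _ hp, C.lintegral_p, mul_one]

/-! ### Integral operators on `L²(π)` whose density is dominated by `p* + p` -/

section IntegralOperator

variable {k : X → X → ℝ≥0}

theorem coe_le_of_le (hle : ∀ x y, k x y ≤ C.pStar x y + C.p x y) (x y : X) :
    (k x y : ℝ≥0∞) ≤ C.pStar x y + C.p x y := by
  rw [← ENNReal.coe_add, ENNReal.coe_le_coe]
  exact hle x y

theorem lintegral_k_le
    (hle : ∀ x y, k x y ≤ C.pStar x y + C.p x y) : ∀ᵐ x ∂C.μ, ∫⁻ y, (k x y : ℝ≥0∞) ∂C.μ ≤ 2 := by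
  filter_upwards [C.lintegral_pStar_le] with x hx
  have hm : Measurable (fun y => (C.p x y : ℝ≥0∞)) :=
    C.measurable_p.coe_nnreal_ennreal.comp measurable_prodMk_left
  calc ∫⁻ y, (k x y : ℝ≥0∞) ∂C.μ ≤ ∫⁻ y, (C.pStar x y + C.p x y : ℝ≥0∞) ∂C.μ :=
        lintegral_mono fun y => C.coe_le_of_le hle x y
    _ = ∫⁻ y, (C.pStar x y : ℝ≥0∞) ∂C.μ + 1 := by
        rw [lintegral_add_right _ hm, C.lintegral_p]
    _ ≤ 1 + 1 := by gcongr
    _ = 2 := one_add_one_eq_two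

theorem lintegral_w_mul_k_le
    (hle : ∀ x y, k x y ≤ C.pStar x y + C.p x y) : ∀ᵐ y ∂C.μ, ∫⁻ x, C.w x * k x y ∂C.μ ≤ 2 * C.w y := by
  filter_upwards [C.lintegral_w_mul_p] with y hy
  have hm : Measurable (fun x => (C.w x * C.p x y : ℝ≥0∞)) :=
    C.measurable_w.coe_nnreal_ennreal.mul
      (C.measurable_p.coe_nnreal_ennreal.comp measurable_prodMk_right)
  calc ∫⁻ x, C.w x * k x y ∂C.μ
      ≤ ∫⁻ x, (C.w x * C.pStar x y + C.w x * C.p x y) ∂C.μ := by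
        refine lintegral_mono fun x => ?_
        rw [← mul_add]
        gcongr
        exact C.coe_le_of_le hle x y
    _ = ∫⁻ x, C.w x * C.pStar x y ∂C.μ + C.w y := by rw [lintegral_add_right _ hm, hy]
    _ ≤ C.w y + C.w y := by gcongr; exact C.lintegral_w_mul_pStar_le y
    _ = 2 * C.w y := (two_mul _).symm

theorem cauchySchwarz (ν : Measure X) {a g : X → ℝ≥0∞} (ha : Measurable a) (hg : Measurable g) :
    (∫⁻ y, a y * g y ∂ν) ^ 2 ≤ (∫⁻ y, a y ∂ν) * ∫⁻ y, a y * g y ^ 2 ∂ν := by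
  have hpq : (2 : ℝ).HolderConjugate 2 := Real.HolderConjugate.two_two
  have h := ENNReal.lintegral_mul_le_Lp_mul_Lq ν hpq
    (f := fun y => a y ^ (1 / 2 : ℝ)) (g := fun y => a y ^ (1 / 2 : ℝ) * g y)
    (ha.pow_const _).aemeasurable ((ha.pow_const _).mul hg).aemeasurable
  have e0 : ∀ t : ℝ≥0∞, t ^ (1 / 2 : ℝ) * t ^ (1 / 2 : ℝ) = t := fun t => by
    rw [← ENNReal.rpow_add_of_nonneg _ _ (by norm_num) (by norm_num)]
    norm_num
  have e1 : ∀ t : ℝ≥0∞, (t ^ (1 / 2 : ℝ)) ^ (2 : ℝ) = t := fun t => by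
    rw [← ENNReal.rpow_mul]
    norm_num
  simp only [Pi.mul_apply, ENNReal.mul_rpow_of_nonneg _ _ (zero_le_two (α := ℝ)), e1,
    ENNReal.rpow_two] at h
  simp only [← mul_assoc, e0] at h
  calc (∫⁻ y, a y * g y ∂ν) ^ 2
      ≤ ((∫⁻ y, a y ∂ν) ^ (1 / 2 : ℝ) * (∫⁻ y, a y * g y ^ 2 ∂ν) ^ (1 / 2 : ℝ)) ^ 2 := by gcongr
    _ = _ := by
      rw [mul_pow, ← ENNReal.rpow_two, ← ENNReal.rpow_two, e1, e1]

theorem lintegral_act_sq_le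
    (hk : Measurable (Function.uncurry k))
    (hle : ∀ x y, k x y ≤ C.pStar x y + C.p x y)
    {g : X → ℝ≥0∞} (hg : Measurable g) :
    ∫⁻ x, ∫⁻ y, k x y * g y ^ 2 ∂C.μ ∂C.π ≤ 2 * ∫⁻ y, g y ^ 2 ∂C.π := by
  have hw : Measurable (fun x => (C.w x : ℝ≥0∞)) := C.measurable_w.coe_nnreal_ennreal
  have hk' : Measurable (fun z : X × X => (k z.1 z.2 : ℝ≥0∞)) := hk.coe_nnreal_ennreal
  have hj : Measurable (fun z : X × X => (k z.1 z.2 : ℝ≥0∞) * g z.2 ^ 2) :=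
    hk'.mul ((hg.comp measurable_snd).pow_const 2)
  have hj' : Measurable (fun z : X × X => (C.w z.1 : ℝ≥0∞) * (k z.1 z.2 * g z.2 ^ 2)) :=
    (hw.comp measurable_fst).mul hj
  rw [C.lintegral_π hj.lintegral_prod_right', C.lintegral_π (hg.pow_const 2)]
  calc ∫⁻ x, C.w x * ∫⁻ y, k x y * g y ^ 2 ∂C.μ ∂C.μ
      = ∫⁻ x, ∫⁻ y, C.w x * (k x y * g y ^ 2) ∂C.μ ∂C.μ := by
        refine lintegral_congr fun x => ?_
        rw [lintegral_const_mul _ (show Measurable fun y => (k x y : ℝ≥0∞) * g y ^ 2 from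
          hj.comp measurable_prodMk_left)]
    _ = ∫⁻ y, ∫⁻ x, C.w x * (k x y * g y ^ 2) ∂C.μ ∂C.μ :=
        lintegral_lintegral_swap hj'.aemeasurable
    _ = ∫⁻ y, (∫⁻ x, C.w x * k x y ∂C.μ) * g y ^ 2 ∂C.μ := by
        refine lintegral_congr fun y => ?_
        rw [← lintegral_mul_const _ (show Measurable fun x => (C.w x * k x y : ℝ≥0∞) from
          hw.mul (hk'.comp measurable_prodMk_right))]
        simp_rw [mul_assoc]
    _ ≤ ∫⁻ y, 2 * (C.w y * g y ^ 2) ∂C.μ := by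
        refine lintegral_mono_ae ?_
        filter_upwards [C.lintegral_w_mul_k_le hle] with y hy
        rw [← mul_assoc]
        gcongr
    _ = 2 * ∫⁻ y, C.w y * g y ^ 2 ∂C.μ := lintegral_const_mul _ (hw.mul (hg.pow_const 2))

theorem lintegral_enorm_sq (f : C.L2) : ∫⁻ x, ‖f x‖ₑ ^ 2 ∂C.π = ‖f‖ₑ ^ 2 := by
  rw [Lp.enorm_def, eLpNorm_eq_lintegral_rpow_enorm_toReal (by norm_num) (by norm_num)]
  simp only [ENNReal.toReal_ofNat, ENNReal.rpow_two]
  rw [← ENNReal.rpow_two, ← ENNReal.rpow_mul]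
  norm_num

/-- The function `x ↦ ∫ k(x, y) f(y) μ(dy)`. -/
def intAct (k : X → X → ℝ≥0) (f : X → ℂ) (x : X) : ℂ := ∫ y, (k x y : ℂ) * f y ∂C.μ

theorem enorm_coe_mul (t : ℝ≥0) (z : ℂ) : ‖((t : ℝ≥0) : ℂ) * z‖ₑ = (t : ℝ≥0∞) * ‖z‖ₑ := by
  rw [enorm_mul]
  congr 1
  rw [enorm_eq_nnnorm]
  congr 1
  ext
  simp

theorem stronglyMeasurable_integrand
    (hk : Measurable (Function.uncurry k))
    (f : C.L2) :
    StronglyMeasurable (fun z : X × X => ((k z.1 z.2 : ℝ≥0) : ℂ) * f z.2) := by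
  have h1 : Measurable (fun z : X × X => ((k z.1 z.2 : ℝ≥0) : ℂ)) :=
    Complex.measurable_ofReal.comp hk.coe_nnreal_real
  exact h1.stronglyMeasurable.mul ((Lp.stronglyMeasurable f).comp_measurable measurable_snd)

theorem integrable_integrand
    (hk : Measurable (Function.uncurry k))
    (hle : ∀ x y, k x y ≤ C.pStar x y + C.p x y)
    (f : C.L2) :
    ∀ᵐ x ∂C.π, Integrable (fun y => ((k x y : ℝ≥0) : ℂ) * f y) C.μ := by
  have hg : Measurable (fun x => ‖f x‖ₑ) := (Lp.stronglyMeasurable f).measurable.enorm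
  have hk' : Measurable (fun z : X × X => (k z.1 z.2 : ℝ≥0∞)) := hk.coe_nnreal_ennreal
  have hj : Measurable (fun z : X × X => (k z.1 z.2 : ℝ≥0∞) * ‖f z.2‖ₑ ^ 2) :=
    hk'.mul ((hg.comp measurable_snd).pow_const 2)
  have hfin : ∫⁻ x, ∫⁻ y, k x y * ‖f y‖ₑ ^ 2 ∂C.μ ∂C.π ≠ ∞ := by
    refine ((C.lintegral_act_sq_le hk hle hg).trans_lt ?_).ne
    rw [C.lintegral_enorm_sq]
    exact ENNReal.mul_lt_top (by simp) (ENNReal.pow_lt_top enorm_lt_top)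
  filter_upwards [ae_lt_top hj.lintegral_prod_right' hfin, C.ae_iff.2 (C.lintegral_k_le hle)]
    with x hx h2
  refine ⟨((C.stronglyMeasurable_integrand hk f).comp_measurable
    measurable_prodMk_left).aestronglyMeasurable, ?_⟩
  rw [hasFiniteIntegral_iff_enorm]
  simp_rw [enorm_coe_mul]
  have hcs := cauchySchwarz C.μ (a := fun y => (k x y : ℝ≥0∞))
    (hk'.comp measurable_prodMk_left) hg
  have hlt : (∫⁻ y, (k x y : ℝ≥0∞) * ‖f y‖ₑ ∂C.μ) ^ 2 < ∞ :=
    hcs.trans_lt (ENNReal.mul_lt_top (h2.trans_lt (by simp)) hx)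
  simpa using hlt

theorem lintegral_intAct_sq_le
    (hk : Measurable (Function.uncurry k))
    (hle : ∀ x y, k x y ≤ C.pStar x y + C.p x y)
    (f : C.L2) :
    ∫⁻ x, ‖C.intAct k f x‖ₑ ^ 2 ∂C.π ≤ (2 * ‖f‖ₑ) ^ 2 := by
  have hg : Measurable (fun x => ‖f x‖ₑ) := (Lp.stronglyMeasurable f).measurable.enorm
  have hk' : Measurable (fun z : X × X => (k z.1 z.2 : ℝ≥0∞)) := hk.coe_nnreal_ennreal
  have hj : Measurable (fun z : X × X => (k z.1 z.2 : ℝ≥0∞) * ‖f z.2‖ₑ ^ 2) :=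
    hk'.mul ((hg.comp measurable_snd).pow_const 2)
  calc ∫⁻ x, ‖C.intAct k f x‖ₑ ^ 2 ∂C.π
      ≤ ∫⁻ x, 2 * ∫⁻ y, k x y * ‖f y‖ₑ ^ 2 ∂C.μ ∂C.π := by
        refine lintegral_mono_ae ?_
        filter_upwards [C.ae_iff.2 (C.lintegral_k_le hle)] with x h2
        calc ‖C.intAct k f x‖ₑ ^ 2 ≤ (∫⁻ y, (k x y : ℝ≥0∞) * ‖f y‖ₑ ∂C.μ) ^ 2 := by
              gcongr
              refine (enorm_integral_le_lintegral_enorm _).trans_eq ?_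
              simp_rw [enorm_coe_mul]
          _ ≤ (∫⁻ y, (k x y : ℝ≥0∞) ∂C.μ) * ∫⁻ y, k x y * ‖f y‖ₑ ^ 2 ∂C.μ :=
              cauchySchwarz C.μ (hk'.comp measurable_prodMk_left) hg
          _ ≤ 2 * ∫⁻ y, k x y * ‖f y‖ₑ ^ 2 ∂C.μ := by gcongr
    _ = 2 * ∫⁻ x, ∫⁻ y, k x y * ‖f y‖ₑ ^ 2 ∂C.μ ∂C.π :=
        lintegral_const_mul _ hj.lintegral_prod_right'
    _ ≤ 2 * (2 * ∫⁻ y, ‖f y‖ₑ ^ 2 ∂C.π) := by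
        gcongr
        exact C.lintegral_act_sq_le hk hle hg
    _ = (2 * ‖f‖ₑ) ^ 2 := by
        rw [C.lintegral_enorm_sq]
        ring

theorem eLpNorm_intAct_le
    (hk : Measurable (Function.uncurry k))
    (hle : ∀ x y, k x y ≤ C.pStar x y + C.p x y)
    (f : C.L2) : eLpNorm (C.intAct k f) 2 C.π ≤ 2 * ‖f‖ₑ := by
  rw [eLpNorm_eq_lintegral_rpow_enorm_toReal (by norm_num) (by norm_num)]
  simp only [ENNReal.toReal_ofNat, ENNReal.rpow_two]
  calc (∫⁻ x, ‖C.intAct k f x‖ₑ ^ 2 ∂C.π) ^ (1 / 2 : ℝ)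
      ≤ ((2 * ‖f‖ₑ) ^ 2) ^ (1 / 2 : ℝ) := by
        gcongr
        exact C.lintegral_intAct_sq_le hk hle f
    _ = 2 * ‖f‖ₑ := by
        rw [← ENNReal.rpow_two, ← ENNReal.rpow_mul]
        norm_num

theorem memLp_intAct
    (hk : Measurable (Function.uncurry k))
    (hle : ∀ x y, k x y ≤ C.pStar x y + C.p x y)
    (f : C.L2) : MemLp (C.intAct k f) 2 C.π := by
  refine ⟨?_, (C.eLpNorm_intAct_le hk hle f).trans_lt
    (ENNReal.mul_lt_top (by simp) enorm_lt_top)⟩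
  exact (C.stronglyMeasurable_integrand hk f).integral_prod_right'.aestronglyMeasurable

/-- The bounded operator `f ↦ ∫ k(·, y) f(y) μ(dy)` on `L²(π)`. -/
def intOp
    (hk : Measurable (Function.uncurry k))
    (hle : ∀ x y, k x y ≤ C.pStar x y + C.p x y) : C.L2 →L[ℂ] C.L2 :=
  LinearMap.mkContinuous
    { toFun := fun f => (C.memLp_intAct hk hle f).toLp
      map_add' := fun f g => by
        rw [← MemLp.toLp_add, MemLp.toLp_eq_toLp_iff]
        filter_upwards [C.integrable_integrand hk hle f, C.integrable_integrand hk hle g]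
          with x hf hg
        simp only [intAct, Pi.add_apply]
        rw [← integral_add hf hg]
        refine integral_congr_ae ?_
        filter_upwards [C.ae_iff.1 (Lp.coeFn_add f g)] with y hy
        rw [hy, Pi.add_apply, mul_add]
      map_smul' := fun c f => by
        rw [RingHom.id_apply, ← MemLp.toLp_const_smul, MemLp.toLp_eq_toLp_iff]
        refine Filter.Eventually.of_forall fun x => ?_
        simp only [intAct, Pi.smul_apply, smul_eq_mul]
        rw [← integral_const_mul]
        refine integral_congr_ae ?_
        filter_upwards [C.ae_iff.1 (Lp.coeFn_smul c f)] with y hy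
        rw [hy, Pi.smul_apply, smul_eq_mul]
        ring }
    2
    (fun f => by
      have h := C.eLpNorm_intAct_le hk hle f
      have h2 : ‖(C.memLp_intAct hk hle f).toLp‖ₑ ≤ 2 * ‖f‖ₑ := by
        rw [Lp.enorm_toLp]
        exact h
      have h3 := ENNReal.toReal_mono (ENNReal.mul_ne_top (by simp) enorm_ne_top) h2
      simpa [ENNReal.toReal_mul] using h3)

theorem intOp_ae
    (hk : Measurable (Function.uncurry k))
    (hle : ∀ x y, k x y ≤ C.pStar x y + C.p x y)
    (f : C.L2) : C.intOp hk hle f =ᵐ[C.π] C.intAct k f :=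
  (C.memLp_intAct hk hle f).coeFn_toLp

end IntegralOperator

/-! ### Multiplication by the rejection probability -/

theorem r₁_ae_eq :
    ∀ᵐ x ∂C.π, C.r₁ x = ∫ y, (1 - (C.α₁ x y : ℝ)) * (C.p x y : ℝ) ∂C.μ := by
  filter_upwards [C.ae_iff.2 C.w_ne_zero] with x hx
  refine setIntegral_eq_integral_of_forall_compl_eq_zero fun y hy => ?_
  have hyx : y = x := by simpa using hy
  subst hyx
  by_cases hp : C.p y y = 0
  · simp [hp]
  · have h : 0 < C.w y * C.p y y := pos_iff_ne_zero.2 (mul_ne_zero hx hp)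
    have h1 : C.α₁ y y = 1 := by
      unfold α₁
      rw [if_pos h, div_self h.ne', min_self]
    simp [h1]

theorem aestronglyMeasurable_r₁ : AEStronglyMeasurable C.r₁ C.π := by
  have h : Measurable (fun z : X × X => (1 - (C.α₁ z.1 z.2 : ℝ)) * (C.p z.1 z.2 : ℝ)) := by
    have e : (fun z : X × X => (1 - (C.α₁ z.1 z.2 : ℝ)) * (C.p z.1 z.2 : ℝ))
        = fun z => (C.p z.1 z.2 : ℝ) - (C.m₁ z.1 z.2 : ℝ) := by
      funext z
      simp only [m₁, NNReal.coe_mul]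
      ring
    rw [e]
    exact C.measurable_p.coe_nnreal_real.sub C.measurable_m₁.coe_nnreal_real
  refine (h.stronglyMeasurable.integral_prod_right' (ν := C.μ)).aestronglyMeasurable.congr ?_
  filter_upwards [C.r₁_ae_eq] with x hx
  exact hx.symm

theorem norm_r₁_le (x : X) : ‖C.r₁ x‖ ≤ 1 := by
  have hp : Measurable (fun y => C.p x y) := C.measurable_p.comp measurable_prodMk_left
  have hint : Integrable (fun y => (C.p x y : ℝ)) C.μ := by
    refine ⟨hp.coe_nnreal_real.aestronglyMeasurable, ?_⟩
    rw [hasFiniteIntegral_iff_enorm]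
    have : ∀ y, ‖(C.p x y : ℝ)‖ₑ = C.p x y := fun y => by
      rw [enorm_eq_nnnorm]
      simp
    simp_rw [this, C.lintegral_p]
    simp
  have hone : ∫ y, (C.p x y : ℝ) ∂C.μ = 1 := by
    rw [integral_eq_lintegral_of_nonneg_ae (Filter.Eventually.of_forall fun y => by positivity)
      hint.1]
    simp [C.lintegral_p]
  have h0 : ∀ y, 0 ≤ 1 - (C.α₁ x y : ℝ) := fun y => by
    have := C.α₁_le_one x y
    have h' : (C.α₁ x y : ℝ) ≤ 1 := by exact_mod_cast this
    linarith
  calc ‖C.r₁ x‖ ≤ ∫ y in ({x}ᶜ : Set X), (C.p x y : ℝ) ∂C.μ := by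
        refine norm_integral_le_of_norm_le hint.integrableOn
          (Filter.Eventually.of_forall fun y => ?_)
        rw [norm_mul, Real.norm_of_nonneg (h0 y), Real.norm_of_nonneg (by positivity)]
        refine mul_le_of_le_one_left (by positivity) ?_
        linarith [(C.α₁ x y).coe_nonneg]
    _ ≤ ∫ y, (C.p x y : ℝ) ∂C.μ :=
        setIntegral_le_integral hint (Filter.Eventually.of_forall fun y => by positivity)
    _ = 1 := hone

theorem norm_r₁_mul_le (f : C.L2) (x : X) : ‖(C.r₁ x : ℂ) * f x‖ ≤ ‖f x‖ := by
  rw [norm_mul, Complex.norm_real]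
  exact mul_le_of_le_one_left (norm_nonneg _) (C.norm_r₁_le x)

theorem memLp_r₁_mul (f : C.L2) : MemLp (fun x => (C.r₁ x : ℂ) * f x) 2 C.π :=
  (Lp.memLp f).mono
    ((Complex.continuous_ofReal.comp_aestronglyMeasurable C.aestronglyMeasurable_r₁).mul
      (Lp.aestronglyMeasurable f))
    (Filter.Eventually.of_forall (C.norm_r₁_mul_le f))

/-- The bounded operator `f ↦ r₁ f` on `L²(π)`. -/
def rejectOp : C.L2 →L[ℂ] C.L2 :=
  LinearMap.mkContinuous
    { toFun := fun f => (C.memLp_r₁_mul f).toLp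
      map_add' := fun f g => by
        rw [← MemLp.toLp_add, MemLp.toLp_eq_toLp_iff]
        filter_upwards [Lp.coeFn_add f g] with x hx
        simp only [hx, Pi.add_apply, mul_add]
      map_smul' := fun c f => by
        rw [RingHom.id_apply, ← MemLp.toLp_const_smul, MemLp.toLp_eq_toLp_iff]
        filter_upwards [Lp.coeFn_smul c f] with x hx
        simp only [hx, Pi.smul_apply, smul_eq_mul]
        ring }
    1
    (fun f => by
      rw [one_mul]
      refine Lp.norm_le_norm_of_ae_le ?_
      filter_upwards [(C.memLp_r₁_mul f).coeFn_toLp] with x hx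
      exact (congrArg norm hx).trans_le (C.norm_r₁_mul_le f x))

theorem rejectOp_ae (f : C.L2) : C.rejectOp f =ᵐ[C.π] fun x => (C.r₁ x : ℂ) * f x :=
  (C.memLp_r₁_mul f).coeFn_toLp

/-! ### The two Metropolis–Hastings kernels as operators on `L²(π)` -/

/-- The first Metropolis–Hastings kernel `M₁` as a bounded operator on `L²(π)`. -/
def M₁ : C.L2 →L[ℂ] C.L2 := C.intOp C.measurable_m₁ C.m₁_le + C.rejectOp

/-- The second Metropolis–Hastings kernel `M₂` as a bounded operator on `L²(π)`. -/
def M₂ : C.L2 →L[ℂ] C.L2 := C.intOp C.measurable_m₂ C.m₂_le - C.rejectOp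

theorem M₁_ae (f : C.L2) : C.M₁ f =ᵐ[C.π] C.M₁act f := by
  have h : C.M₁ f = C.intOp C.measurable_m₁ C.m₁_le f + C.rejectOp f := rfl
  rw [h]
  filter_upwards [Lp.coeFn_add (C.intOp C.measurable_m₁ C.m₁_le f) (C.rejectOp f),
    C.intOp_ae C.measurable_m₁ C.m₁_le f, C.rejectOp_ae f] with x h1 h2 h3
  rw [h1, Pi.add_apply, h2, h3]
  rfl

theorem M₂_ae (f : C.L2) : C.M₂ f =ᵐ[C.π] C.M₂act f := by
  have h : C.M₂ f = C.intOp C.measurable_m₂ C.m₂_le f - C.rejectOp f := rfl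
  rw [h]
  filter_upwards [Lp.coeFn_sub (C.intOp C.measurable_m₂ C.m₂_le f) (C.rejectOp f),
    C.intOp_ae C.measurable_m₂ C.m₂_le f, C.rejectOp_ae f] with x h1 h2 h3
  rw [h1, Pi.sub_apply, h2, h3]
  rfl

/-! ### Metastability of a partition -/

/-- `Q(A, B) = π(A)⁻¹ ∫_A P(x, B) π(dx)`, which is `0` if `π(A) = 0`. -/
def Q (A B : Set X) : ℝ := (∫ x in A, (C.P x).real B ∂C.π) / C.π.real A

/-- The metastability `m(𝒟) = ∑ Q(A_i, A_i)`. -/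
def metastability {n : ℕ} (A : Fin n → Set X) : ℝ := ∑ i, C.Q (A i) (A i)

/-- The indicator of a measurable set as an element of `L²(π)`. -/
def ind {s : Set X} (hs : MeasurableSet s) : C.L2 :=
  indicatorConstLp 2 hs (measure_ne_top C.π s) (1 : ℂ)

/-- The span of the indicators of the sets of a finite family. -/
def indSpan {n : ℕ} {A : Fin n → Set X} (hA : ∀ i, MeasurableSet (A i)) : Submodule ℂ C.L2 :=
  Submodule.span ℂ (Set.range fun i => C.ind (hA i))

instance {n : ℕ} {A : Fin n → Set X} (hA : ∀ i, MeasurableSet (A i)) :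
    FiniteDimensional ℂ (C.indSpan hA) :=
  FiniteDimensional.span_of_finite ℂ (Set.finite_range _)

/-- The orthogonal projection `Γ` of `L²(π)` onto the span of the indicators. -/
def Γ {n : ℕ} {A : Fin n → Set X} (hA : ∀ i, MeasurableSet (A i)) : C.L2 →L[ℂ] C.L2 :=
  (C.indSpan hA).starProjection

end StationaryChain

/-- The dominant-spectrum assumption on an operator `T`: its eigenvalues above `b` are
`1 = lam 0 > lam 1 ≥ … ≥ lam (n - 1)`, listed with multiplicity, and the rest of its spectrum lies
in `[a, b]`, where `-1 < a ≤ b < lam (n - 1)`. -/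
structure DominantSpectrum {H : Type*} [NormedAddCommGroup H] [NormedSpace ℂ H]
    (T : H →L[ℂ] H) {n : ℕ} [NeZero n] (lam : Fin n → ℝ) (a b : ℝ) : Prop where
  lam_zero : lam 0 = 1
  lam_lt_one : ∀ j, j ≠ 0 → lam j < 1
  antitone : Antitone lam
  neg_one_lt : -1 < a
  a_le_b : a ≤ b
  b_lt : ∀ j, b < lam j
  finrank_eigenspace : ∀ j,
    Module.finrank ℂ (Module.End.eigenspace (T : H →ₗ[ℂ] H) (lam j : ℂ))
      = {i | lam i = lam j}.ncard
  spectrum_subset : spectrum ℂ T ⊆ Complex.ofReal '' (Set.Icc a b ∪ Set.range lam)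

end MHChain

end

noncomputable section

namespace MHChain

/-! ### Quadratic forms and traces of self-adjoint operators -/

section Hilbert

variable {H : Type*} [NormedAddCommGroup H] [InnerProductSpace ℂ H]

/-! Let `u_i` be the indicators of the sets `A_i`, normalized in `L²(π)`. Then `m(𝒟) = ∑ ⟨u_i, P
u_i⟩` is the trace of the compression of `P` to their span. `P` need not be self-adjoint, but
detailed balance makes `M₁` and `M₂` self-adjoint, and they bracket `P` on indicators. Rejection in
`M₁` only keeps mass inside a set, so `⟨1_A, P 1_A⟩ ≤ ⟨1_A, M₁ 1_A⟩` (`le_re_inner_M₁_ind`). From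
`min + max = sum` comes `M₁ + M₂ = P + P*`, and `P`, `P*` have the same real form on `1_A`; hence
`⟨1_A, M₂ 1_A⟩ ≤ ⟨1_A, P 1_A⟩` (`re_inner_M₂_ind_le`).

It remains to bound traces over `n` orthonormal vectors. Above, this is Ky Fan's principle
(`DominantSpectrum.upper_trace_bound`): `T ≤ b + ∑ (m - b) E_m` over the distinct dominant
eigenvalues `m`, where the trace of the spectral projection `E_m` is at most the multiplicity of
`m`. Below (`lower_trace_bound`), the eigenvectors `φ_j` contribute `λ_j` times their overlap `ρ_j`
with the span, and the rest of the spectrum is at least `a`, giving `∑ (ρ_j λ_j + a (1 - ρ_j))`. The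
eigenvalue `1` of `M₂` is simple with constant eigenfunctions, which lie in the span, so the overlap
of index `0` is `1`. -/

theorem re_inner_le_re_inner_of_le {S T : H →L[ℂ] H} (h : S ≤ T) (v : H) :
    (inner ℂ v (S v)).re ≤ (inner ℂ v (T v)).re := by
  have h1 := ((ContinuousLinearMap.le_def S T).1 h).re_inner_nonneg_right v
  rw [sub_apply, inner_sub_right, map_sub] at h1
  exact sub_nonneg.1 h1

theorem mem_of_mem_spectrum_real {T : H →L[ℂ] H} {s : Set ℝ}
    (h : spectrum ℂ T ⊆ Complex.ofReal '' s) {x : ℝ} (hx : x ∈ spectrum ℝ T) : x ∈ s := by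
  obtain ⟨y, hy, hyx⟩ := h (spectrum.algebraMap_mem ℂ hx)
  rwa [Complex.ofReal_injective hyx] at hy

/-- Bessel's inequality for a finite orthonormal family. -/
theorem sum_norm_inner_sq_le {ι : Type*} [Fintype ι] {u : ι → H} (hu : Orthonormal ℂ u) (v : H) :
    ∑ i, ‖inner ℂ (u i) v‖ ^ 2 ≤ ‖v‖ ^ 2 :=
  hu.sum_inner_products_le v (s := Finset.univ)

variable [CompleteSpace H]

theorem le_re_inner_of_le_spectrum {T : H →L[ℂ] H} (hT : IsSelfAdjoint T) {a : ℝ}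
    (ha : ∀ x ∈ spectrum ℝ T, a ≤ x) (v : H) : a * ‖v‖ ^ 2 ≤ (inner ℂ v (T v)).re := by
  have h := re_inner_le_re_inner_of_le ((algebraMap_le_iff_le_spectrum (a := T) hT).2 ha) v
  rw [Algebra.algebraMap_eq_smul_one, smul_apply, one_apply_eq_self,
    inner_smul_right_eq_smul, Complex.smul_re,
    inner_self_eq_norm_sq_to_K] at h
  simpa [← Complex.ofReal_pow] using h

/-- The span of the `φ j` is invariant under the self-adjoint `T`, so the quadratic form splits
along it and its orthogonal complement; on the complement it is at least `a ‖·‖²`. The bound for a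
single `v` is then summed over `v = u i`. -/
theorem lower_trace_bound {ι κ : Type*} [Fintype ι] [Fintype κ] {T : H →L[ℂ] H}
    (hT : IsSelfAdjoint T) {a : ℝ} (ha : ∀ x ∈ spectrum ℝ T, a ≤ x)
    {φ : κ → H} (hφ : Orthonormal ℂ φ) {l : κ → ℝ} (hl : ∀ j, T (φ j) = (l j : ℂ) • φ j)
    {u : ι → H} (hu : Orthonormal ℂ u) :
    a * Fintype.card ι + ∑ j, (l j - a) * ∑ i, ‖inner ℂ (u i) (φ j)‖ ^ 2
      ≤ ∑ i, (inner ℂ (u i) (T (u i))).re := by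
  have key : ∀ v : H, a * ‖v‖ ^ 2 + ∑ j, (l j - a) * ‖inner ℂ v (φ j)‖ ^ 2
      ≤ (inner ℂ v (T v)).re := by
    intro v
    -- `w` is the orthogonal projection of `v` onto the span of the `φ j`.
    set w : H := ∑ j, inner ℂ (φ j) v • φ j with hw
    have hTw : T w = ∑ j, ((l j : ℂ) * inner ℂ (φ j) v) • φ j := by
      rw [hw, map_sum]
      exact Finset.sum_congr rfl fun j _ => by rw [map_smul, hl, smul_smul, mul_comm]
    have hsymm : ∀ x y, inner ℂ (T x) y = inner ℂ x (T y) := hT.isSymmetric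
    have hc : ∀ j, inner ℂ v (φ j) * inner ℂ (φ j) v = ((‖inner ℂ v (φ j)‖ ^ 2 : ℝ) : ℂ) := by
      intro j
      rw [← inner_conj_symm (φ j) v, Complex.mul_conj, Complex.normSq_eq_norm_sq]
    have h1 : inner ℂ v (T w) = ((∑ j, l j * ‖inner ℂ v (φ j)‖ ^ 2 : ℝ) : ℂ) := by
      rw [hTw, inner_sum, Complex.ofReal_sum]
      refine Finset.sum_congr rfl fun j _ => ?_
      rw [inner_smul_right, Complex.ofReal_mul, ← hc]
      ring
    have h2 : inner ℂ w (T w) = ((∑ j, l j * ‖inner ℂ v (φ j)‖ ^ 2 : ℝ) : ℂ) := by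
      rw [hTw, hw, hφ.inner_sum, Complex.ofReal_sum]
      refine Finset.sum_congr rfl fun j _ => ?_
      rw [Complex.ofReal_mul, ← hc, inner_conj_symm]
      ring
    have h3 : inner ℂ w (T v) = ((∑ j, l j * ‖inner ℂ v (φ j)‖ ^ 2 : ℝ) : ℂ) := by
      rw [← hsymm, ← inner_conj_symm, h1, Complex.conj_ofReal]
    have h4 : inner ℂ v w = ((∑ j, ‖inner ℂ v (φ j)‖ ^ 2 : ℝ) : ℂ) := by
      rw [hw, inner_sum, Complex.ofReal_sum]
      refine Finset.sum_congr rfl fun j _ => ?_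
      rw [inner_smul_right, ← hc, mul_comm]
    have h5 : ‖w‖ ^ 2 = ∑ j, ‖inner ℂ v (φ j)‖ ^ 2 := by
      have : inner ℂ w w = ((∑ j, ‖inner ℂ v (φ j)‖ ^ 2 : ℝ) : ℂ) := by
        rw [hw, hφ.inner_sum, Complex.ofReal_sum]
        refine Finset.sum_congr rfl fun j _ => ?_
        rw [← hc, inner_conj_symm]
      rw [inner_self_eq_norm_sq_to_K] at this
      exact Complex.ofReal_injective (by simpa using this)
    -- The cross terms `⟨v, T w⟩`, `⟨w, T v⟩` and `⟨w, T w⟩` all coincide, so passing from `v` to `v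
    -- - w` subtracts exactly the eigenvector part of the form.
    have h6 := le_re_inner_of_le_spectrum hT ha (v - w)
    have h7 : (inner ℂ (v - w) (T (v - w))).re
        = (inner ℂ v (T v)).re - ∑ j, l j * ‖inner ℂ v (φ j)‖ ^ 2 := by
      rw [map_sub, inner_sub_left, inner_sub_right, inner_sub_right, h1, h2, h3]
      simp only [Complex.sub_re, Complex.ofReal_re]
      ring
    have h8 : ‖v - w‖ ^ 2 = ‖v‖ ^ 2 - ∑ j, ‖inner ℂ v (φ j)‖ ^ 2 := by
      rw [@norm_sub_sq ℂ, h4, h5]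
      simp only [RCLike.re_to_complex, Complex.ofReal_re]
      ring
    rw [h7, h8] at h6
    simp only [sub_mul, Finset.sum_sub_distrib, ← Finset.mul_sum]
    linarith
  calc a * Fintype.card ι + ∑ j, (l j - a) * ∑ i, ‖inner ℂ (u i) (φ j)‖ ^ 2
      = ∑ i, (a * ‖u i‖ ^ 2 + ∑ j, (l j - a) * ‖inner ℂ (u i) (φ j)‖ ^ 2) := by
        rw [Finset.sum_add_distrib, Finset.sum_comm]
        simp [hu.norm_eq_one, Finset.mul_sum, mul_comm]
    _ ≤ _ := Finset.sum_le_sum fun i _ => key (u i)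

/-- An operator with values in a finite-dimensional subspace which is a self-adjoint projection has
trace at most the dimension. -/
theorem sum_re_inner_le_finrank {ι : Type*} [Fintype ι] {E : H →L[ℂ] H} (hE : IsSelfAdjoint E)
    (hEE : E * E = E) {K : Submodule ℂ H} [FiniteDimensional ℂ K] (hK : ∀ v, E v ∈ K)
    {u : ι → H} (hu : Orthonormal ℂ u) :
    ∑ i, (inner ℂ (u i) (E (u i))).re ≤ Module.finrank ℂ K := by
  have hsymm : ∀ v w, inner ℂ (E v) w = inner ℂ v (E w) := hE.isSymmetric
  have hidem : ∀ v, E (E v) = E v := fun v => congrArg (fun S : H →L[ℂ] H => S v) hEE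
  have hre : ∀ v, (inner ℂ v (E v)).re = ‖E v‖ ^ 2 := by
    intro v
    rw [← hidem v, ← hsymm, hidem, inner_self_eq_norm_sq_to_K]
    simp [← Complex.ofReal_pow]
  have hle : ∀ v, ‖E v‖ ^ 2 ≤ ‖v‖ ^ 2 := by
    intro v
    have h1 : ‖E v‖ * ‖E v‖ ≤ ‖v‖ * ‖E v‖ := by
      rw [← sq, ← hre]
      exact (Complex.re_le_norm _).trans (norm_inner_le_norm _ _)
    gcongr
    by_contra! h
    nlinarith [norm_nonneg v]
  let e := stdOrthonormalBasis ℂ K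
  -- Moving `E` onto the basis vectors of `K` lets the sums be exchanged: Bessel for `u`, applied to
  -- `E (e k)`, bounds each of the `finrank K` terms by `‖E (e k)‖² ≤ 1`.
  have hexp : ∀ v, ‖E v‖ ^ 2 = ∑ k, ‖inner ℂ v (E (e k : H))‖ ^ 2 := by
    intro v
    have h := e.sum_sq_norm_inner_right ⟨E v, hK v⟩
    simp only [Submodule.coe_inner, Submodule.coe_norm] at h
    rw [← h]
    exact Finset.sum_congr rfl fun k _ => by rw [← hsymm, norm_inner_symm]
  calc ∑ i, (inner ℂ (u i) (E (u i))).re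
      = ∑ k, ∑ i, ‖inner ℂ (u i) (E (e k : H))‖ ^ 2 := by
        rw [Finset.sum_comm]
        exact Finset.sum_congr rfl fun i _ => by rw [hre, hexp]
    _ ≤ ∑ _k : Fin (Module.finrank ℂ K), (1 : ℝ) := by
        refine Finset.sum_le_sum fun k _ => (sum_norm_inner_sq_le hu _).trans ((hle _).trans ?_)
        have : ‖(e k : H)‖ = 1 := e.orthonormal.1 k
        simp [this]
    _ = Module.finrank ℂ K := by simp

/-- As `m` is separated from `s`, the indicator of `m` on the spectrum extends to a continuous `g`.
There `g² = g` and `x g(x) = m g(x)`, identities that pass to `cfc g T`. The function itself is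
returned because operator inequalities are later checked pointwise. -/
theorem exists_spectral_projection {T : H →L[ℂ] H} (hT : IsSelfAdjoint T) {m : ℝ} {s : Set ℝ}
    (hs : IsClosed s) (hm : m ∉ s) (hspec : spectrum ℝ T ⊆ s ∪ {m}) :
    ∃ g : C(ℝ, ℝ), g m = 1 ∧ (∀ x ∈ s, g x = 0) ∧ IsSelfAdjoint (cfc g T) ∧
      cfc g T * cfc g T = cfc g T ∧ T * cfc g T = m • cfc g T := by
  obtain ⟨g, h0, h1, -⟩ := exists_continuous_zero_one_of_isClosed hs (isClosed_singleton (x := m))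
    (Set.disjoint_singleton_right.2 hm)
  have h1' : g m = 1 := h1 rfl
  have h0' : ∀ x ∈ s, g x = 0 := fun x hx => h0 hx
  refine ⟨g, h1', h0', cfc_predicate _ _, ?_, ?_⟩
  · rw [← cfc_mul g g T]
    refine cfc_congr fun x hx => ?_
    rcases hspec hx with h | rfl
    · simp [h0' x h]
    · simp [h1']
  · have hid := cfc_mul (fun x => x) g T
    rw [cfc_id' ℝ T] at hid
    rw [← hid, ← cfc_const_mul m g T]
    refine cfc_congr fun x hx => ?_
    rcases hspec hx with h | rfl
    · simp [h0' x h]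
    · simp [h1']

/-- Ky Fan's principle. On the spectrum `x ≤ b + ∑ (m - b) g_m(x)`: the sum vanishes on `[a, b]`,
and equality holds at each `lam j`. Since `m - b ≥ 0`, bounding the trace of each projection by the
multiplicity suffices. -/
theorem DominantSpectrum.upper_trace_bound {T : H →L[ℂ] H} (hT : IsSelfAdjoint T)
    {n : ℕ} [NeZero n] {lam : Fin n → ℝ} {a b : ℝ} (h : DominantSpectrum T lam a b)
    {u : Fin n → H} (hu : Orthonormal ℂ u) :
    ∑ i, (inner ℂ (u i) (T (u i))).re ≤ ∑ j, lam j := by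
  classical
  -- A spectral projection belongs to a value and not to an index, so repeated eigenvalues are
  -- merged; multiplicities return as fibre cardinalities.
  let M : Finset ℝ := Finset.univ.image lam
  have hM : ∀ {m}, m ∈ M ↔ ∃ j, lam j = m := by simp [M]
  have hsp : spectrum ℝ T ⊆ Set.Icc a b ∪ Set.range lam := fun x hx =>
    mem_of_mem_spectrum_real h.spectrum_subset hx
  have hproj : ∀ m : ℝ, ∃ g : C(ℝ, ℝ), m ∈ M → g m = 1 ∧
      (∀ x ∈ Set.Icc a b ∪ (M.erase m : Set ℝ), g x = 0) ∧ IsSelfAdjoint (cfc g T) ∧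
      cfc g T * cfc g T = cfc g T ∧ T * cfc g T = m • cfc g T := by
    intro m
    by_cases hm : m ∈ M
    · obtain ⟨j, rfl⟩ := hM.1 hm
      obtain ⟨g, hg⟩ := exists_spectral_projection hT (m := lam j)
        (s := Set.Icc a b ∪ (M.erase (lam j) : Set ℝ))
        (isClosed_Icc.union (Finset.finite_toSet _).isClosed)
        (by simp [h.b_lt j]) (fun x hx => by
          rcases hsp hx with hx | ⟨i, rfl⟩
          · exact Or.inl (Or.inl hx)
          · by_cases hij : lam i = lam j
            · exact Or.inr hij
            · exact Or.inl (Or.inr (by simp [hij, M])))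
      exact ⟨g, fun _ => hg⟩
    -- A dummy value off `M`, so that `choose` yields a function on all of `ℝ`.
    · exact ⟨0, fun h => absurd h hm⟩
  choose g hg using hproj
  have hle : T ≤ algebraMap ℝ (H →L[ℂ] H) b + ∑ m ∈ M, (m - b) • cfc (g m) T := by
    have e : algebraMap ℝ (H →L[ℂ] H) b + ∑ m ∈ M, (m - b) • cfc (g m) T
        = cfc (fun x => b + ∑ m ∈ M, (m - b) * g m x) T := by
      have hsum := cfc_sum (fun m x => (m - b) * g m x) T M
      rw [Finset.sum_fn] at hsum
      rw [cfc_const_add b _ T, hsum]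
      exact congrArg _ (Finset.sum_congr rfl fun m _ => (cfc_const_mul (m - b) (g m) T).symm)
    rw [e]
    conv_lhs => rw [← cfc_id' ℝ T]
    refine cfc_mono fun x hx => ?_
    rcases hsp hx with hx | ⟨j, rfl⟩
    · rw [Finset.sum_eq_zero fun m hm => by rw [(hg m hm).2.1 x (Or.inl hx), mul_zero], add_zero]
      exact hx.2
    · have hj : lam j ∈ M := hM.2 ⟨j, rfl⟩
      rw [Finset.sum_eq_single_of_mem _ hj fun m hm hne => by
        rw [(hg m hm).2.1 _ (Or.inr (by simp [hne.symm, M])), mul_zero], (hg _ hj).1]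
      linarith
  have htr : ∀ m ∈ M, ∑ i, (inner ℂ (u i) (cfc (g m) T (u i))).re
      ≤ ((Finset.univ.filter fun i => lam i = m).card : ℝ) := by
    intro m hm
    obtain ⟨j, rfl⟩ := hM.1 hm
    have hfr := h.finrank_eigenspace j
    have hcard : {i | lam i = lam j}.ncard = (Finset.univ.filter fun i => lam i = lam j).card := by
      rw [← Set.ncard_coe_finset]
      simp
    rw [hcard] at hfr
    -- Positive `finrank` excludes its default value `0` for infinite dimension, so the eigenspace
    -- is truly finite-dimensional.
    have hpos : 0 < (Finset.univ.filter fun i => lam i = lam j).card :=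
      Finset.card_pos.2 ⟨j, by simp⟩
    rw [← hfr] at hpos ⊢
    have := Module.finite_of_finrank_pos hpos
    refine sum_re_inner_le_finrank (hg _ hm).2.2.1 (hg _ hm).2.2.2.1 (fun v => ?_) hu
    rw [Module.End.mem_eigenspace_iff]
    exact congrArg (fun S : H →L[ℂ] H => S v) (hg _ hm).2.2.2.2
  calc ∑ i, (inner ℂ (u i) (T (u i))).re
      ≤ ∑ i, (b + ∑ m ∈ M, (m - b) * (inner ℂ (u i) (cfc (g m) T (u i))).re) := by
        refine Finset.sum_le_sum fun i _ => (re_inner_le_re_inner_of_le hle (u i)).trans_eq ?_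
        rw [add_apply, inner_add_right, Complex.add_re, sum_apply, inner_sum, Complex.re_sum,
          Algebra.algebraMap_eq_smul_one, smul_apply, one_apply_eq_self, inner_smul_right_eq_smul,
          Complex.smul_re, inner_self_eq_norm_sq_to_K, hu.norm_eq_one]
        simp only [smul_apply, inner_smul_right_eq_smul, Complex.smul_re]
        simp
    _ = n * b + ∑ m ∈ M, (m - b) * ∑ i, (inner ℂ (u i) (cfc (g m) T (u i))).re := by
        rw [Finset.sum_add_distrib, Finset.sum_comm]
        simp [Finset.mul_sum]
    _ ≤ n * b + ∑ m ∈ M, (m - b) * (Finset.univ.filter fun i => lam i = m).card := by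
        gcongr with m hm
        · obtain ⟨j, rfl⟩ := hM.1 hm
          exact sub_nonneg.2 (h.b_lt j).le
        · exact htr m hm
    _ = ∑ j, lam j := by
        have h1 : ∑ m ∈ M, (m - b) * (Finset.univ.filter fun i => lam i = m).card
            = ∑ j, (lam j - b) := by
          rw [← Finset.sum_fiberwise_of_maps_to (t := M) (g := lam) (fun j _ => hM.2 ⟨j, rfl⟩)]
          refine Finset.sum_congr rfl fun m _ => ?_
          rw [Finset.sum_congr rfl (g := fun _ => m - b) fun j hj => by
            rw [(Finset.mem_filter.1 hj).2]]
          rw [Finset.sum_const, nsmul_eq_mul, mul_comm]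
        rw [h1]
        simp

end Hilbert

namespace StationaryChain

/-! ### Adjoints of integral operators -/

variable {X : Type*} [MeasurableSpace X] (C : StationaryChain X)

/-- Over `μ ⊗ μ` the two coordinates can be swapped, which `π ⊗ μ` does not allow. -/
theorem integral_π_prod (F : X × X → ℂ) :
    ∫ z, F z ∂(C.π.prod C.μ) = ∫ z, C.w z.1 • F z ∂(C.μ.prod C.μ) := by
  rw [C.π_eq, prod_withDensity_left C.measurable_w.coe_nnreal_ennreal]
  exact integral_withDensity_eq_integral_smul (C.measurable_w.comp measurable_fst) F

section Adjoint

variable {k k' : X → X → ℝ≥0}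

/-- Justifies Fubini. With `st ≤ s² + t²`, the two squares are controlled by the column and row
masses of `k` respectively. -/
theorem integrable_kernel_mul (hk : Measurable (Function.uncurry k))
    (hle : ∀ x y, k x y ≤ C.pStar x y + C.p x y) (f g : C.L2) :
    Integrable (fun z : X × X => (k z.1 z.2 : ℂ) * g z.2 * starRingEnd ℂ (f z.1))
      (C.π.prod C.μ) := by
  have hf : Measurable (fun x => ‖f x‖ₑ) := (Lp.stronglyMeasurable f).measurable.enorm
  have hg : Measurable (fun x => ‖g x‖ₑ) := (Lp.stronglyMeasurable g).measurable.enorm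
  have hk' : Measurable (fun z : X × X => (k z.1 z.2 : ℝ≥0∞)) := hk.coe_nnreal_ennreal
  have hm1 : Measurable (fun z : X × X => (k z.1 z.2 : ℝ≥0∞) * ‖g z.2‖ₑ ^ 2) :=
    hk'.mul ((hg.comp measurable_snd).pow_const 2)
  have hm2 : Measurable (fun z : X × X => (k z.1 z.2 : ℝ≥0∞) * ‖f z.1‖ₑ ^ 2) :=
    hk'.mul ((hf.comp measurable_fst).pow_const 2)
  have hsm : StronglyMeasurable
      (fun z : X × X => (k z.1 z.2 : ℂ) * g z.2 * starRingEnd ℂ (f z.1)) :=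
    (C.stronglyMeasurable_integrand hk g).mul
      (Complex.continuous_conj.comp_stronglyMeasurable
        ((Lp.stronglyMeasurable f).comp_measurable measurable_fst))
  refine ⟨hsm.aestronglyMeasurable, ?_⟩
  rw [hasFiniteIntegral_iff_enorm]
  have hb : ∀ s t : ℝ≥0∞, s * t ≤ s ^ 2 + t ^ 2 := by
    intro s t
    rcases le_total s t with h | h
    · exact (mul_le_mul_left h t).trans (by rw [sq t]; exact le_add_self)
    · exact (mul_le_mul_right h s).trans (by rw [sq s]; exact le_self_add)
  calc ∫⁻ z, ‖(k z.1 z.2 : ℂ) * g z.2 * starRingEnd ℂ (f z.1)‖ₑ ∂(C.π.prod C.μ)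
      ≤ ∫⁻ z, (k z.1 z.2 * ‖g z.2‖ₑ ^ 2 + k z.1 z.2 * ‖f z.1‖ₑ ^ 2) ∂(C.π.prod C.μ) := by
        refine lintegral_mono fun z => ?_
        rw [enorm_mul, enorm_coe_mul, RCLike.enorm_conj, mul_assoc, ← mul_add]
        gcongr
        exact hb _ _
    _ = ∫⁻ x, ∫⁻ y, k x y * ‖g y‖ₑ ^ 2 ∂C.μ ∂C.π + ∫⁻ x, ∫⁻ y, k x y * ‖f x‖ₑ ^ 2 ∂C.μ ∂C.π := by
        rw [lintegral_add_left hm1, lintegral_prod _ hm1.aemeasurable,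
          lintegral_prod _ hm2.aemeasurable]
    _ ≤ 2 * ‖g‖ₑ ^ 2 + 2 * ‖f‖ₑ ^ 2 := by
        rw [← C.lintegral_enorm_sq f, ← C.lintegral_enorm_sq g]
        gcongr
        · exact C.lintegral_act_sq_le hk hle hg
        · rw [← lintegral_const_mul _ (hf.pow_const 2)]
          refine lintegral_mono_ae ?_
          filter_upwards [C.ae_iff.2 (C.lintegral_k_le hle)] with x hx
          rw [lintegral_mul_const _ (show Measurable fun y => (k x y : ℝ≥0∞) from
            hk'.comp measurable_prodMk_left)]
          gcongr
    _ < ∞ := by simp [ENNReal.mul_lt_top, ENNReal.add_lt_top]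

theorem inner_intOp_right (hk : Measurable (Function.uncurry k))
    (hle : ∀ x y, k x y ≤ C.pStar x y + C.p x y) (f g : C.L2) :
    inner ℂ f (C.intOp hk hle g)
      = ∫ z, C.w z.1 • ((k z.1 z.2 : ℂ) * g z.2 * starRingEnd ℂ (f z.1)) ∂(C.μ.prod C.μ) := by
  rw [← C.integral_π_prod, integral_prod _ (C.integrable_kernel_mul hk hle f g), L2.inner_def]
  refine integral_congr_ae ?_
  filter_upwards [C.intOp_ae hk hle g] with x hx
  rw [hx, RCLike.inner_apply, intAct, integral_mul_const]

/-- Kernels with `w(x) k(x, y) = w(y) k'(y, x)` define adjoint operators. -/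
theorem inner_intOp_left_eq (hk : Measurable (Function.uncurry k))
    (hle : ∀ x y, k x y ≤ C.pStar x y + C.p x y) (hk' : Measurable (Function.uncurry k'))
    (hle' : ∀ x y, k' x y ≤ C.pStar x y + C.p x y)
    (hkk' : ∀ x y, C.w x ≠ 0 → C.w y ≠ 0 → C.w x * k x y = C.w y * k' y x) (f g : C.L2) :
    inner ℂ (C.intOp hk' hle' f) g = inner ℂ f (C.intOp hk hle g) := by
  rw [← inner_conj_symm, inner_intOp_right, inner_intOp_right, ← integral_conj,
    ← integral_prod_swap]
  refine integral_congr_ae ?_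
  -- The symmetry relation is available only where both weights are nonzero, which is almost
  -- everywhere for `μ ⊗ μ`.
  filter_upwards [Measure.quasiMeasurePreserving_fst.ae C.w_ne_zero,
    Measure.quasiMeasurePreserving_snd.ae C.w_ne_zero] with z h1 h2
  have h : (C.w z.1 : ℂ) * (k z.1 z.2 : ℂ) = (C.w z.2 : ℂ) * (k' z.2 z.1 : ℂ) := by
    exact_mod_cast congrArg (fun t : ℝ≥0 => ((t : ℝ) : ℂ)) (hkk' z.1 z.2 h1 h2)
  simp only [Prod.fst_swap, Prod.snd_swap, NNReal.smul_def, Complex.real_smul, map_mul,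
    Complex.conj_conj, Complex.conj_ofReal]
  linear_combination (-(g z.2 * starRingEnd ℂ (f z.1))) * h

end Adjoint

/-! ### Detailed balance and self-adjointness of `M₁` and `M₂` -/

theorem w_mul_pStar {x : X} (hx : C.w x ≠ 0) (y : X) : C.w x * C.pStar x y = C.w y * C.p y x :=
  mul_div_cancel₀ _ hx

/-- Multiplying the minimum by `w x` gives `min (w y * p y x) (w x * p x y)`, symmetric in `x` and
`y`. -/
theorem w_mul_m₁ (x y : X) (hx : C.w x ≠ 0) (hy : C.w y ≠ 0) :
    C.w x * C.m₁ x y = C.w y * C.m₁ y x := by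
  rw [m₁_eq_min, m₁_eq_min, mul_min, mul_min, C.w_mul_pStar hx, C.w_mul_pStar hy, min_comm]

theorem w_mul_m₂ (x y : X) (hx : C.w x ≠ 0) (hy : C.w y ≠ 0) :
    C.w x * C.m₂ x y = C.w y * C.m₂ y x := by
  rw [m₂, m₂, mul_max, mul_max, C.w_mul_pStar hx, C.w_mul_pStar hy, max_comm]

theorem isSelfAdjoint_rejectOp : IsSelfAdjoint C.rejectOp := by
  rw [ContinuousLinearMap.isSelfAdjoint_iff_isSymmetric]
  intro f g
  change inner ℂ (C.rejectOp f) g = inner ℂ f (C.rejectOp g)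
  rw [L2.inner_def, L2.inner_def]
  refine integral_congr_ae ?_
  filter_upwards [C.rejectOp_ae f, C.rejectOp_ae g] with x hf hg
  rw [hf, hg, RCLike.inner_apply, RCLike.inner_apply, map_mul, Complex.conj_ofReal]
  ring

theorem isSelfAdjoint_M₁ : IsSelfAdjoint C.M₁ := by
  refine IsSelfAdjoint.add ?_ C.isSelfAdjoint_rejectOp
  rw [ContinuousLinearMap.isSelfAdjoint_iff_isSymmetric]
  exact C.inner_intOp_left_eq _ _ _ _ C.w_mul_m₁

theorem isSelfAdjoint_M₂ : IsSelfAdjoint C.M₂ := by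
  refine IsSelfAdjoint.sub ?_ C.isSelfAdjoint_rejectOp
  rw [ContinuousLinearMap.isSelfAdjoint_iff_isSymmetric]
  exact C.inner_intOp_left_eq _ _ _ _ C.w_mul_m₂

/-! ### Comparison of the quadratic forms on indicators -/

theorem p_le (x y : X) : C.p x y ≤ C.pStar x y + C.p x y := le_add_self

theorem pStar_le (x y : X) : C.pStar x y ≤ C.pStar x y + C.p x y := le_self_add

/-- The operator of the chain `P`. -/
def opP : C.L2 →L[ℂ] C.L2 := C.intOp C.measurable_p C.p_le

/-- The operator of the time reversal `P*`. -/
def opPStar : C.L2 →L[ℂ] C.L2 := C.intOp C.measurable_pStar C.pStar_le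

theorem inner_opPStar_left (f g : C.L2) : inner ℂ (C.opPStar f) g = inner ℂ f (C.opP g) := by
  refine C.inner_intOp_left_eq _ _ _ _ (fun x y _ hy => (C.w_mul_pStar hy x).symm) f g

/-- The rejection terms cancel and the densities satisfy `min + max = p + p*`. -/
theorem M₁_add_M₂ : C.M₁ + C.M₂ = C.opP + C.opPStar := by
  ext1 f
  have h : (C.M₁ + C.M₂) f
      = C.intOp C.measurable_m₁ C.m₁_le f + C.intOp C.measurable_m₂ C.m₂_le f := by
    simp only [M₁, M₂, add_apply, sub_apply]
    abel
  rw [h, add_apply]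
  refine Lp.ext ?_
  filter_upwards [Lp.coeFn_add (C.intOp C.measurable_m₁ C.m₁_le f)
      (C.intOp C.measurable_m₂ C.m₂_le f), Lp.coeFn_add (C.opP f) (C.opPStar f),
    C.intOp_ae C.measurable_m₁ C.m₁_le f, C.intOp_ae C.measurable_m₂ C.m₂_le f,
    C.intOp_ae C.measurable_p C.p_le f, C.intOp_ae C.measurable_pStar C.pStar_le f,
    C.integrable_integrand C.measurable_m₁ C.m₁_le f,
    C.integrable_integrand C.measurable_m₂ C.m₂_le f,
    C.integrable_integrand C.measurable_p C.p_le f,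
    C.integrable_integrand C.measurable_pStar C.pStar_le f]
    with x e1 e2 e3 e4 e5 e6 i1 i2 i3 i4
  rw [e1, e2, Pi.add_apply, Pi.add_apply, e3, e4]
  refine Eq.trans ?_ (congrArg₂ (· + ·) e5 e6).symm
  simp only [intAct]
  rw [← integral_add i1 i2, ← integral_add i3 i4]
  refine integral_congr_ae (Filter.Eventually.of_forall fun y => ?_)
  have hs : C.m₁ x y + C.m₂ x y = C.p x y + C.pStar x y := by
    rw [m₁_eq_min, m₂, min_add_max, add_comm]
  have hs' : (C.m₁ x y : ℂ) + C.m₂ x y = C.p x y + C.pStar x y := by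
    exact_mod_cast congrArg (fun t : ℝ≥0 => ((t : ℝ) : ℂ)) hs
  simp only [← add_mul, hs']

theorem intAct_ind {k : X → X → ℝ≥0} {s : Set X} (hs : MeasurableSet s) (x : X) :
    C.intAct k (C.ind hs) x = ((∫ y in s, (k x y : ℝ) ∂C.μ : ℝ) : ℂ) := by
  rw [intAct, ← integral_complex_ofReal, ← integral_indicator hs]
  refine integral_congr_ae ?_
  filter_upwards [C.ae_iff.1 (indicatorConstLp_coeFn (p := 2) (hs := hs)
    (hμs := measure_ne_top C.π s) (c := (1 : ℂ)))] with y hy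
  rw [ind, hy]
  by_cases h : y ∈ s <;> simp [h]

theorem inner_ind_left {s : Set X} (hs : MeasurableSet s) (f : C.L2) :
    inner ℂ (C.ind hs) f = ∫ x in s, f x ∂C.π :=
  L2.inner_indicatorConstLp_one hs _ f

theorem integrable_p (x : X) : Integrable (fun y => (C.p x y : ℝ)) C.μ := by
  have hp : Measurable (fun y => C.p x y) := C.measurable_p.comp measurable_prodMk_left
  refine ⟨hp.coe_nnreal_real.aestronglyMeasurable, ?_⟩
  rw [hasFiniteIntegral_iff_enorm]
  have : ∀ y, ‖(C.p x y : ℝ)‖ₑ = C.p x y := fun y => by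
    rw [enorm_eq_nnnorm]
    simp
  simp_rw [this, C.lintegral_p]
  simp

theorem m₁_le_p (x y : X) : C.m₁ x y ≤ C.p x y := by
  rw [m₁_eq_min]
  exact min_le_right _ _

theorem integrable_m₁ (x : X) : Integrable (fun y => (C.m₁ x y : ℝ)) C.μ := by
  have hm : Measurable (fun y => C.m₁ x y) := C.measurable_m₁.comp measurable_prodMk_left
  refine (C.integrable_p x).mono hm.coe_nnreal_real.aestronglyMeasurable
    (Filter.Eventually.of_forall fun y => ?_)
  rw [Real.norm_of_nonneg (by positivity), Real.norm_of_nonneg (by positivity)]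
  exact_mod_cast C.m₁_le_p x y

theorem P_real_eq (x : X) {s : Set X} (hs : MeasurableSet s) :
    (C.P x).real s = ∫ y in s, (C.p x y : ℝ) ∂C.μ := by
  rw [integral_eq_lintegral_of_nonneg_ae (Filter.Eventually.of_forall fun y => by positivity)
    (C.integrable_p x).integrableOn.1, Measure.real, C.P_eq, withDensity_apply _ hs]
  simp

theorem integral_p_eq_one (x : X) : ∫ y, (C.p x y : ℝ) ∂C.μ = 1 := by
  rw [← setIntegral_univ, ← C.P_real_eq x MeasurableSet.univ]
  simp

theorem r₁_ae_eq_sub :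
    ∀ᵐ x ∂C.π, C.r₁ x = 1 - ∫ y, (C.m₁ x y : ℝ) ∂C.μ := by
  filter_upwards [C.r₁_ae_eq] with x hx
  rw [← C.integral_p_eq_one x, ← integral_sub (C.integrable_p x) (C.integrable_m₁ x), hx]
  refine integral_congr_ae (Filter.Eventually.of_forall fun y => ?_)
  simp only [m₁, NNReal.coe_mul]
  ring

theorem inner_ind_opP {s : Set X} (hs : MeasurableSet s) :
    inner ℂ (C.ind hs) (C.opP (C.ind hs)) = ((∫ x in s, (C.P x).real s ∂C.π : ℝ) : ℂ) := by
  rw [inner_ind_left, ← integral_complex_ofReal]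
  refine integral_congr_ae (ae_restrict_of_ae ?_)
  filter_upwards [C.intOp_ae C.measurable_p C.p_le (C.ind hs)] with x hx
  rw [opP, hx, C.intAct_ind hs, C.P_real_eq x hs]

theorem M₁_ind_ae {s : Set X} (hs : MeasurableSet s) :
    ∀ᵐ x ∂C.π, C.M₁ (C.ind hs) x = ((∫ y in s, (C.m₁ x y : ℝ) ∂C.μ +
      (1 - ∫ y, (C.m₁ x y : ℝ) ∂C.μ) * s.indicator (fun _ => (1 : ℝ)) x : ℝ) : ℂ) := by
  filter_upwards [C.M₁_ae (C.ind hs), C.r₁_ae_eq_sub, indicatorConstLp_coeFn (p := 2) (hs := hs)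
    (hμs := measure_ne_top C.π s) (c := (1 : ℂ))] with x h1 h2 h3
  have h4 := C.intAct_ind (k := C.m₁) hs x
  rw [intAct] at h4
  rw [h1, M₁act, h4, h2, ind, h3, Complex.ofReal_add, Complex.ofReal_mul]
  by_cases h : x ∈ s <;> simp [h]

/-- For `x ∈ s`, the value of `M₁ 1_s` is `1 - ∫_{sᶜ} m₁ ≥ 1 - ∫_{sᶜ} p = P(x, s)`: rejecting moves
reduces the mass leaving `s`. -/
theorem le_re_inner_M₁_ind {s : Set X} (hs : MeasurableSet s) :
    ∫ x in s, (C.P x).real s ∂C.π ≤ (inner ℂ (C.ind hs) (C.M₁ (C.ind hs))).re := by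
  have hint : Integrable (fun x => C.M₁ (C.ind hs) x) (C.π.restrict s) :=
    ((Lp.memLp _).integrable (by norm_num)).integrableOn
  rw [inner_ind_left, ← RCLike.re_to_complex, ← integral_re hint]
  refine integral_mono_of_nonneg (Filter.Eventually.of_forall fun x => by positivity)
    hint.re ?_
  filter_upwards [ae_restrict_of_ae (C.M₁_ind_ae hs), ae_restrict_mem hs] with x hx hxs
  simp only [hx, RCLike.re_to_complex, Complex.ofReal_re]
  rw [Set.indicator_of_mem hxs, mul_one, C.P_real_eq x hs, ← C.integral_p_eq_one x,
    ← integral_add_compl hs (C.integrable_p x), ← integral_add_compl hs (C.integrable_m₁ x)]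
  have : ∫ y in sᶜ, (C.m₁ x y : ℝ) ∂C.μ ≤ ∫ y in sᶜ, (C.p x y : ℝ) ∂C.μ :=
    integral_mono (C.integrable_m₁ x).integrableOn (C.integrable_p x).integrableOn
      fun y => by exact_mod_cast C.m₁_le_p x y
  linarith

/-- Write `M₂ = P + P* - M₁`. The forms of `P` and `P*` on `1_s` are conjugate and real, hence equal
to some `q`, and that of `M₁` is at least `q`; so `2q` minus it is at most `q`. -/
theorem re_inner_M₂_ind_le {s : Set X} (hs : MeasurableSet s) :
    (inner ℂ (C.ind hs) (C.M₂ (C.ind hs))).re ≤ ∫ x in s, (C.P x).real s ∂C.π := by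
  have h1 : inner ℂ (C.ind hs) (C.M₁ (C.ind hs)) + inner ℂ (C.ind hs) (C.M₂ (C.ind hs))
      = inner ℂ (C.ind hs) (C.opP (C.ind hs)) + inner ℂ (C.ind hs) (C.opPStar (C.ind hs)) := by
    rw [← inner_add_right, ← inner_add_right, ← add_apply, C.M₁_add_M₂, add_apply]
  rw [← inner_conj_symm (C.ind hs) (C.opPStar _), inner_opPStar_left, inner_ind_opP,
    Complex.conj_ofReal] at h1
  have h2 := congrArg Complex.re h1
  simp only [Complex.add_re, Complex.ofReal_re] at h2
  linarith [C.le_re_inner_M₁_ind hs]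

/-! ### Constants are invariant -/

theorem ind_univ_ae : ∀ᵐ x ∂C.π, C.ind MeasurableSet.univ x = 1 := by
  filter_upwards [indicatorConstLp_coeFn (p := 2) (hs := MeasurableSet.univ)
    (hμs := measure_ne_top C.π Set.univ) (c := (1 : ℂ))] with x hx
  rw [ind, hx]
  simp

/-- This is stationarity in density form, divided by `w x`. -/
theorem integral_pStar : ∀ᵐ x ∂C.π, ∫ y, (C.pStar x y : ℝ) ∂C.μ = 1 := by
  filter_upwards [C.ae_iff.2 C.lintegral_w_mul_p, C.ae_iff.2 C.w_ne_zero] with x hx hx0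
  have hm : Measurable (fun y => C.pStar x y) := C.measurable_pStar.comp measurable_prodMk_left
  have hp : Measurable (fun y => (C.p y x : ℝ≥0∞)) :=
    C.measurable_p.coe_nnreal_ennreal.comp measurable_prodMk_right
  rw [integral_eq_lintegral_of_nonneg_ae (Filter.Eventually.of_forall fun y => by positivity)
    hm.coe_nnreal_real.aestronglyMeasurable]
  have h : ∀ y, ENNReal.ofReal (C.pStar x y : ℝ) = (C.w x : ℝ≥0∞)⁻¹ * (C.w y * C.p y x) := by
    intro y
    rw [ENNReal.ofReal_coe_nnreal, pStar, ENNReal.coe_div hx0, ENNReal.div_eq_inv_mul,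
      ENNReal.coe_mul]
  simp_rw [h]
  rw [lintegral_const_mul _ (show Measurable fun y => (C.w y * C.p y x : ℝ≥0∞) from
    C.measurable_w.coe_nnreal_ennreal.mul hp), hx, ENNReal.inv_mul_cancel (by simpa) (by simp)]
  simp

/-- `P`, `P*` and `M₁` fix constants, hence so does `M₂ = P + P* - M₁`. -/
theorem M₂_ind_univ : C.M₂ (C.ind MeasurableSet.univ) = C.ind MeasurableSet.univ := by
  have h1 : C.M₁ (C.ind MeasurableSet.univ) + C.M₂ (C.ind MeasurableSet.univ)
      = C.opP (C.ind MeasurableSet.univ) + C.opPStar (C.ind MeasurableSet.univ) := by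
    rw [← add_apply, C.M₁_add_M₂, add_apply]
  have hP : C.opP (C.ind MeasurableSet.univ) = C.ind MeasurableSet.univ := by
    refine Lp.ext ?_
    filter_upwards [C.intOp_ae C.measurable_p C.p_le (C.ind MeasurableSet.univ), C.ind_univ_ae]
      with x hx h1
    rw [opP, hx, C.intAct_ind, h1, setIntegral_univ, C.integral_p_eq_one, Complex.ofReal_one]
  have hPs : C.opPStar (C.ind MeasurableSet.univ) = C.ind MeasurableSet.univ := by
    refine Lp.ext ?_
    filter_upwards [C.intOp_ae C.measurable_pStar C.pStar_le (C.ind MeasurableSet.univ),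
      C.ind_univ_ae, C.integral_pStar] with x hx h1 h2
    rw [opPStar, hx, C.intAct_ind, h1, setIntegral_univ, h2, Complex.ofReal_one]
  have hM : C.M₁ (C.ind MeasurableSet.univ) = C.ind MeasurableSet.univ := by
    refine Lp.ext ?_
    filter_upwards [C.M₁_ind_ae MeasurableSet.univ, C.ind_univ_ae] with x hx h1
    rw [hx, h1, setIntegral_univ]
    simp
  rw [hP, hPs, hM] at h1
  exact add_left_cancel h1

/-! ### The orthonormal family of normalized indicators -/

theorem inner_ind_ind {s t : Set X} (hs : MeasurableSet s) (ht : MeasurableSet t) :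
    inner ℂ (C.ind hs) (C.ind ht) = ((C.π.real (s ∩ t) : ℝ) : ℂ) := by
  rw [ind, ind, L2.inner_indicatorConstLp_indicatorConstLp]
  simp

section Partition

variable {n : ℕ} {A : Fin n → Set X} (hA : ∀ i, MeasurableSet (A i))

/-- The indicators of a family of sets, normalized in `L²(π)`. -/
def normInd (i : Fin n) : C.L2 := (((Real.sqrt (C.π.real (A i)))⁻¹ : ℝ) : ℂ) • C.ind (hA i)

variable {hA}

theorem real_pos {s : Set X} (hpos : 0 < C.π s) : 0 < C.π.real s :=
  ENNReal.toReal_pos hpos.ne' (measure_ne_top _ _)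

theorem orthonormal_normInd (hdisj : Pairwise (Function.onFun Disjoint A))
    (hpos : ∀ i, 0 < C.π (A i)) : Orthonormal ℂ (C.normInd hA) := by
  rw [orthonormal_iff_ite]
  intro i j
  rw [normInd, normInd, inner_smul_left, inner_smul_right, inner_ind_ind, Complex.conj_ofReal]
  split_ifs with h
  · subst h
    rw [Set.inter_self, ← Complex.ofReal_mul, ← Complex.ofReal_mul, ← Complex.ofReal_one]
    congr 1
    have h1 := Real.mul_self_sqrt (C.real_pos (hpos i)).le
    have h2 := Real.sqrt_pos.2 (C.real_pos (hpos i))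
    field_simp
    rw [sq, h1]
  · rw [(hdisj h).inter_eq]
    simp

theorem Γ_eq_sum (hdisj : Pairwise (Function.onFun Disjoint A)) (hpos : ∀ i, 0 < C.π (A i))
    (v : C.L2) : C.Γ hA v = ∑ i, inner ℂ (C.normInd hA i) v • C.normInd hA i := by
  have hmem : ∀ i, C.normInd hA i ∈ C.indSpan hA := fun i =>
    Submodule.smul_mem _ _ (Submodule.subset_span ⟨i, rfl⟩)
  have hind : ∀ i, C.ind (hA i) = ((Real.sqrt (C.π.real (A i)) : ℝ) : ℂ) • C.normInd hA i := by
    intro i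
    rw [normInd, smul_smul, ← Complex.ofReal_mul,
      mul_inv_cancel₀ (Real.sqrt_pos.2 (C.real_pos (hpos i))).ne', Complex.ofReal_one, one_smul]
  refine Submodule.eq_starProjection_of_mem_orthogonal
    (Submodule.sum_mem _ fun i _ => Submodule.smul_mem _ _ (hmem i)) ?_
  rw [indSpan, Submodule.mem_orthogonal]
  intro x hx
  induction hx using Submodule.span_induction with
  | mem x hx =>
    obtain ⟨i, rfl⟩ := hx
    change inner ℂ (C.ind (hA i)) _ = 0
    rw [hind, inner_smul_left, inner_sub_right,
      (C.orthonormal_normInd hdisj hpos).inner_right_fintype, sub_self, mul_zero]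
  | zero => exact inner_zero_left _
  | add x y _ _ hx hy => rw [inner_add_left, hx, hy, add_zero]
  | smul c x _ hx => rw [inner_smul_left, hx, mul_zero]

/-- Identifies the `ρ j` of the theorem with the overlaps in `lower_trace_bound`. -/
theorem norm_Γ_sq (hdisj : Pairwise (Function.onFun Disjoint A)) (hpos : ∀ i, 0 < C.π (A i))
    (v : C.L2) : ‖C.Γ hA v‖ ^ 2 = ∑ i, ‖inner ℂ (C.normInd hA i) v‖ ^ 2 := by
  have h : inner ℂ (C.Γ hA v) (C.Γ hA v)
      = ((∑ i, ‖inner ℂ (C.normInd hA i) v‖ ^ 2 : ℝ) : ℂ) := by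
    rw [C.Γ_eq_sum hdisj hpos, (C.orthonormal_normInd hdisj hpos).inner_sum, Complex.ofReal_sum]
    refine Finset.sum_congr rfl fun i _ => ?_
    rw [← Complex.normSq_eq_norm_sq, Complex.normSq_eq_conj_mul_self]
  rw [inner_self_eq_norm_sq_to_K] at h
  exact Complex.ofReal_injective (by simpa using h)

/-- The factor `1 / π(A i)` in `Q` is exactly the normalization of the indicators; this is what
turns metastability into a trace. -/
theorem re_inner_normInd (T : C.L2 →L[ℂ] C.L2) (i : Fin n) :
    (inner ℂ (C.normInd hA i) (T (C.normInd hA i))).re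
      = (inner ℂ (C.ind (hA i)) (T (C.ind (hA i)))).re / C.π.real (A i) := by
  rw [normInd, map_smul, inner_smul_left, inner_smul_right, Complex.conj_ofReal, ← mul_assoc,
    ← Complex.ofReal_mul, Complex.re_ofReal_mul, ← mul_inv,
    Real.mul_self_sqrt measureReal_nonneg, div_eq_inv_mul]

theorem metastability_le_sum_M₁ :
    C.metastability A ≤ ∑ i, (inner ℂ (C.normInd hA i) (C.M₁ (C.normInd hA i))).re := by
  refine Finset.sum_le_sum fun i _ => ?_
  rw [re_inner_normInd, Q]
  gcongr
  exact C.le_re_inner_M₁_ind (hA i)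

theorem sum_M₂_le_metastability :
    ∑ i, (inner ℂ (C.normInd hA i) (C.M₂ (C.normInd hA i))).re ≤ C.metastability A := by
  refine Finset.sum_le_sum fun i _ => ?_
  rw [re_inner_normInd, Q]
  gcongr
  exact C.re_inner_M₂_ind_le (hA i)

theorem ind_univ_eq_sum (hdisj : Pairwise (Function.onFun Disjoint A))
    (hcover : ⋃ i, A i = Set.univ) : C.ind MeasurableSet.univ = ∑ i, C.ind (hA i) := by
  refine Lp.ext ?_
  have h : ∀ᵐ x ∂C.π, ∀ i, C.ind (hA i) x = (A i).indicator (fun _ => (1 : ℂ)) x :=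
    ae_all_iff.2 fun i => indicatorConstLp_coeFn
  have hsum : (∑ i, C.ind (hA i) : C.L2) =ᵐ[C.π] ∑ i, (C.ind (hA i) : X → ℂ) := Lp.coeFn_finsetSum _ _
  filter_upwards [C.ind_univ_ae, h, hsum] with x h1 h2 h3
  rw [h1, h3, Finset.sum_apply]
  obtain ⟨i, hi⟩ := Set.mem_iUnion.1 (hcover ▸ Set.mem_univ x : x ∈ ⋃ i, A i)
  rw [Finset.sum_eq_single i, h2, Set.indicator_of_mem hi]
  · intro j _ hj
    rw [h2, Set.indicator_of_notMem fun hxj => (hdisj hj).le_bot ⟨hxj, hi⟩]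
  · simp

theorem ind_univ_mem_indSpan (hdisj : Pairwise (Function.onFun Disjoint A))
    (hcover : ⋃ i, A i = Set.univ) : C.ind MeasurableSet.univ ∈ C.indSpan hA := by
  rw [C.ind_univ_eq_sum (hA := hA) hdisj hcover]
  exact Submodule.sum_mem _ fun i _ => Submodule.subset_span ⟨i, rfl⟩

end Partition

/-! ### Simplicity of the eigenvalue `1` of `M₂` -/

theorem ind_univ_ne_zero : C.ind MeasurableSet.univ ≠ 0 := by
  intro h
  have h1 := C.inner_ind_ind MeasurableSet.univ MeasurableSet.univ
  rw [h, inner_zero_left] at h1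
  simp at h1

/-- The eigenvalue `1` of `M₂` is simple, so that its eigenfunctions are constant. -/
theorem exists_smul_ind_univ {n : ℕ} [NeZero n] {lam : Fin n → ℝ} {a b : ℝ}
    (h : DominantSpectrum C.M₂ lam a b) {f : C.L2} (hf : C.M₂ f = (lam 0 : ℂ) • f) :
    ∃ c : ℂ, f = c • C.ind MeasurableSet.univ := by
  have hone : C.M₂ (C.ind MeasurableSet.univ) = (lam 0 : ℂ) • C.ind MeasurableSet.univ := by
    rw [h.lam_zero, Complex.ofReal_one, one_smul, C.M₂_ind_univ]
  -- The strict gap `lam i < 1` for `i ≠ 0` makes the eigenspace one-dimensional.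
  have hset : {i | lam i = lam 0} = {0} := by
    ext i
    simp only [Set.mem_ofPred_eq, Set.mem_singleton_iff]
    refine ⟨fun hi => ?_, fun hi => by rw [hi]⟩
    by_contra h0
    exact (h.lam_lt_one i h0).ne (hi.trans h.lam_zero)
  have hfr := h.finrank_eigenspace 0
  rw [hset, Set.ncard_singleton] at hfr
  let K := Module.End.eigenspace (C.M₂ : C.L2 →ₗ[ℂ] C.L2) (lam 0 : ℂ)
  let v : K := ⟨C.ind MeasurableSet.univ, Module.End.mem_eigenspace_iff.2 hone⟩
  have hv : v ≠ 0 := fun h0 => C.ind_univ_ne_zero (congrArg Subtype.val h0)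
  obtain ⟨c, hc⟩ := (finrank_eq_one_iff_of_nonzero' v hv).1 hfr
    ⟨f, Module.End.mem_eigenspace_iff.2 hf⟩
  exact ⟨c, (congrArg Subtype.val hc).symm⟩

end StationaryChain

end MHChain

end

/-! ### The two bounds on metastability -/

theorem mainTheorem7 {X : Type*} [MeasurableSpace X] (C : MHChain.StationaryChain X)
    {n : ℕ} [NeZero n]
    (lam₁ lam₂ : Fin n → ℝ) (a₁ b₁ a b : ℝ)
    (h₁ : MHChain.DominantSpectrum C.M₁ lam₁ a₁ b₁)
    (h₂ : MHChain.DominantSpectrum C.M₂ lam₂ a b)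
    (φ : Fin n → C.L2) (hφ : Orthonormal ℂ φ)
    (hφ_eigen : ∀ j, C.M₂ (φ j) = (lam₂ j : ℂ) • φ j)
    (A : Fin n → Set X) (hA : ∀ i, MeasurableSet (A i))
    (hdisj : Pairwise (Function.onFun Disjoint A)) (hcover : ⋃ i, A i = Set.univ)
    (hpos : ∀ i, 0 < C.π (A i))
    (ρ : Fin n → ℝ) (hρ : ∀ j, ρ j = ‖C.Γ hA (φ j)‖ ^ 2)
    (c : ℝ) (hc : c = a * ∑ j ∈ Finset.univ.erase (0 : Fin n), (1 - ρ j)) :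
    (∀ j, ρ j ∈ Set.Icc (0 : ℝ) 1) ∧
    1 + ∑ j ∈ Finset.univ.erase (0 : Fin n), ρ j * lam₂ j + c ≤ C.metastability A ∧
    C.metastability A ≤ 1 + ∑ j ∈ Finset.univ.erase (0 : Fin n), lam₁ j := by
  have hu := C.orthonormal_normInd (hA := hA) hdisj hpos
  have hρ' : ∀ j, ρ j = ∑ i, ‖inner ℂ (C.normInd hA i) (φ j)‖ ^ 2 := fun j => by
    rw [hρ, C.norm_Γ_sq hdisj hpos]
  -- `φ 0` is constant, hence fixed by `Γ`.
  have hρ0 : ρ 0 = 1 := by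
    obtain ⟨c, hc⟩ := C.exists_smul_ind_univ h₂ (hφ_eigen 0)
    have hmem : φ 0 ∈ C.indSpan hA :=
      hc ▸ Submodule.smul_mem _ c (C.ind_univ_mem_indSpan hdisj hcover)
    rw [hρ, MHChain.StationaryChain.Γ, Submodule.starProjection_eq_self_iff.2 hmem,
      hφ.norm_eq_one, one_pow]
  refine ⟨fun j => ⟨?_, ?_⟩, ?_, ?_⟩
  · rw [hρ]
    positivity
  · rw [hρ']
    refine (MHChain.sum_norm_inner_sq_le hu (φ j)).trans ?_
    rw [hφ.norm_eq_one, one_pow]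
  · have ha : ∀ x ∈ spectrum ℝ C.M₂, a ≤ x := by
      intro x hx
      rcases MHChain.mem_of_mem_spectrum_real h₂.spectrum_subset hx with hx | ⟨j, rfl⟩
      · exact hx.1
      · exact h₂.a_le_b.trans (h₂.b_lt j).le
    refine le_trans (le_of_eq ?_) ((MHChain.lower_trace_bound C.isSelfAdjoint_M₂ ha hφ hφ_eigen
      hu).trans (C.sum_M₂_le_metastability (hA := hA)))
    -- One copy of `a` goes to each `j`. The term `j = 0` is then `1`, because `ρ 0 = 1`, and the
    -- terms `a * (1 - ρ j)` with `j ≠ 0` add up to `c`.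
    have hsum : a * Fintype.card (Fin n) + ∑ j, (lam₂ j - a) * ρ j
        = ∑ j, (ρ j * lam₂ j + a * (1 - ρ j)) := by
      have hcard : a * Fintype.card (Fin n) = ∑ _j : Fin n, a := by simp [mul_comm]
      rw [hcard, ← Finset.sum_add_distrib]
      exact Finset.sum_congr rfl fun j _ => by ring
    simp_rw [← hρ']
    rw [hsum, ← Finset.add_sum_erase _ _ (Finset.mem_univ (0 : Fin n)), hρ0, h₂.lam_zero,
      Finset.sum_add_distrib, ← Finset.mul_sum, hc]
    ring
  · refine (C.metastability_le_sum_M₁ (hA := hA)).trans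
      ((h₁.upper_trace_bound C.isSelfAdjoint_M₁ hu).trans_eq ?_)
    rw [← Finset.add_sum_erase _ _ (Finset.mem_univ (0 : Fin n)), h₁.lam_zero]
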